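/- For a continuous map $f\colon M\to N$ of closed connected $n$-manifolds, the degree of $f$ modulo $2$ is the element $\deg_2 f\in\mathbb Z_2$ with $f^*u=(\deg_2 f)\,v$, where $u$ and $v$ are the generators of the singular cohomology groups $H^n(N;\mathbb Z_2)\cong\mathbb Z_2$ and $H^n(M;\mathbb Z_2)\cong\mathbb Z_2$, and $f^*\colon H^n(N;\mathbb Z_2)\to H^n(M;\mathbb Z_2)$ is the homomorphism induced by $f$. Theorem. Let $T^2=S^1\times S^1$ be the torus, let $P^2$ be the real projective plane and let $K^2$ be the Klein bottle. There is no continuous map $g\colon P^2\to T^2$ with $\deg_2 g=1$, and there is no continuous map $g\colon K^2\to T^2$ with $\deg_2 g=1$. -/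

import Mathlib

open CategoryTheory

noncomputable section

namespace Mod2Degree

/-! ### Cohomology with coefficients in `ℤ/2` of a chain complex of `ℤ/2`-vector spaces -/

/-- The `n`-cochains of a chain complex: the linear functionals on its `n`-chains. -/
def Cochain (C : ChainComplex (ModuleCat.{0} (ZMod 2)) ℕ) (n : ℕ) : Type :=
  C.X n →ₗ[ZMod 2] ZMod 2

instance (C : ChainComplex (ModuleCat.{0} (ZMod 2)) ℕ) (n : ℕ) : AddCommGroup (Cochain C n) :=
  inferInstanceAs (AddCommGroup (C.X n →ₗ[ZMod 2] ZMod 2))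

instance (C : ChainComplex (ModuleCat.{0} (ZMod 2)) ℕ) (n : ℕ) : Module (ZMod 2) (Cochain C n) :=
  inferInstanceAs (Module (ZMod 2) (C.X n →ₗ[ZMod 2] ZMod 2))

/-- The transpose `Cochain C i → Cochain C j` of the boundary map `C_j → C_i`; it is the
coboundary operator if `j = i + 1`, and `0` otherwise. -/
def coboundary (C : ChainComplex (ModuleCat.{0} (ZMod 2)) ℕ) (i j : ℕ) :
    Cochain C i →ₗ[ZMod 2] Cochain C j :=
  (C.d j i).hom.dualMap

/-- The pullback of cochains along a chain map. -/
def cochainMap {C D : ChainComplex (ModuleCat.{0} (ZMod 2)) ℕ} (f : C ⟶ D) (n : ℕ) :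
    Cochain D n →ₗ[ZMod 2] Cochain C n :=
  (f.f n).hom.dualMap

/-- The pullback of cochains commutes with the coboundary. -/
theorem coboundary_cochainMap {C D : ChainComplex (ModuleCat.{0} (ZMod 2)) ℕ} (f : C ⟶ D)
    (i j : ℕ) (φ : Cochain D i) :
    coboundary C i j (cochainMap f i φ) = cochainMap f j (coboundary D i j φ) := by
  refine LinearMap.ext fun c => ?_
  exact (congrArg (fun g => φ.toFun (g.hom c)) (f.comm j i)).symm

/-- The `n`-cocycles. -/
def cocycles (C : ChainComplex (ModuleCat.{0} (ZMod 2)) ℕ) (n : ℕ) :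
    Submodule (ZMod 2) (Cochain C n) :=
  LinearMap.ker (coboundary C n (n + 1))

/-- The `n`-coboundaries. In degree `0` this is `⊥`, as the component of the differential from
degree `0` to degree `0 - 1 = 0` is `0`. -/
def coboundaries (C : ChainComplex (ModuleCat.{0} (ZMod 2)) ℕ) (n : ℕ) :
    Submodule (ZMod 2) (Cochain C n) :=
  LinearMap.range (coboundary C (n - 1) n)

/-- The cohomology in degree `n`: cocycles modulo coboundaries. -/
def Cohomology (C : ChainComplex (ModuleCat.{0} (ZMod 2)) ℕ) (n : ℕ) : Type :=
  cocycles C n ⧸ (coboundaries C n).comap (cocycles C n).subtype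

instance (C : ChainComplex (ModuleCat.{0} (ZMod 2)) ℕ) (n : ℕ) : AddCommGroup (Cohomology C n) :=
  inferInstanceAs (AddCommGroup
    (cocycles C n ⧸ (coboundaries C n).comap (cocycles C n).subtype))

instance (C : ChainComplex (ModuleCat.{0} (ZMod 2)) ℕ) (n : ℕ) :
    Module (ZMod 2) (Cohomology C n) :=
  inferInstanceAs (Module (ZMod 2)
    (cocycles C n ⧸ (coboundaries C n).comap (cocycles C n).subtype))

/-- The pullback of cocycles along a chain map. -/
def cocyclesMap {C D : ChainComplex (ModuleCat.{0} (ZMod 2)) ℕ} (f : C ⟶ D) (n : ℕ) :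
    cocycles D n →ₗ[ZMod 2] cocycles C n :=
  (cochainMap f n).restrict fun φ hφ => by
    have h : coboundary D n (n + 1) φ = 0 := hφ
    change coboundary C n (n + 1) (cochainMap f n φ) = 0
    rw [coboundary_cochainMap, h, map_zero]

/-- The homomorphism induced in cohomology by a chain map. -/
def cohomologyMap {C D : ChainComplex (ModuleCat.{0} (ZMod 2)) ℕ} (f : C ⟶ D) (n : ℕ) :
    Cohomology D n →ₗ[ZMod 2] Cohomology C n :=
  Submodule.mapQ ((coboundaries D n).comap (cocycles D n).subtype)
    ((coboundaries C n).comap (cocycles C n).subtype) (cocyclesMap f n) <| by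
    rintro ⟨φ, hφ⟩ ⟨ψ, hψ⟩
    exact ⟨cochainMap f (n - 1) ψ, (coboundary_cochainMap f (n - 1) n ψ).trans
      (congrArg (cochainMap f n) hψ)⟩

/-! ### Singular cohomology with coefficients in `ℤ/2` -/

/-- The singular chain complex of `X` with coefficients in `ℤ/2`. -/
def singularChains (X : Type) [TopologicalSpace X] : ChainComplex (ModuleCat.{0} (ZMod 2)) ℕ :=
  ((AlgebraicTopology.singularChainComplexFunctor (ModuleCat.{0} (ZMod 2))).obj
    (ModuleCat.of (ZMod 2) (ZMod 2))).obj (TopCat.of X)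

/-- The chain map induced on singular chains by a continuous map. -/
def singularChainsMap {X Y : Type} [TopologicalSpace X] [TopologicalSpace Y] (f : C(X, Y)) :
    singularChains X ⟶ singularChains Y :=
  ((AlgebraicTopology.singularChainComplexFunctor (ModuleCat.{0} (ZMod 2))).obj
    (ModuleCat.of (ZMod 2) (ZMod 2))).map (TopCat.ofHom f)

/-- The singular cohomology group `Hⁿ(X; ℤ/2)`. -/
abbrev SingularCohomology (X : Type) [TopologicalSpace X] (n : ℕ) : Type :=
  Cohomology (singularChains X) n

/-- The homomorphism `f^* : Hⁿ(Y; ℤ/2) → Hⁿ(X; ℤ/2)` induced by a continuous map. -/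
def pullback {X Y : Type} [TopologicalSpace X] [TopologicalSpace Y] (f : C(X, Y)) (n : ℕ) :
    SingularCohomology Y n →ₗ[ZMod 2] SingularCohomology X n :=
  cohomologyMap (singularChainsMap f) n

/-! ### The degree modulo 2 -/

/-- `u` is a generator of `Hⁿ(X; ℤ/2) ≃ ℤ/2`: it is nonzero and it spans the whole group. -/
def IsGenerator {X : Type} [TopologicalSpace X] {n : ℕ} (u : SingularCohomology X n) : Prop :=
  u ≠ 0 ∧ ∀ v : SingularCohomology X n, ∃ c : ZMod 2, v = c • u

/-- The degree modulo 2 of a continuous map `f : M → N` of closed connected `n`-manifolds is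
`d`: we have `f^* u = d • v` for the generators `u` of `Hⁿ(N; ℤ/2) ≃ ℤ/2` and `v` of
`Hⁿ(M; ℤ/2) ≃ ℤ/2`. -/
def HasDegree (n : ℕ) {M N : Type} [TopologicalSpace M] [TopologicalSpace N] (f : C(M, N))
    (d : ZMod 2) : Prop :=
  ∃ (u : SingularCohomology N n) (v : SingularCohomology M n),
    IsGenerator u ∧ IsGenerator v ∧ pullback f n u = d • v

/-! ### The surfaces -/

/-- The torus `T² = S¹ × S¹`. -/
abbrev Torus : Type := Circle × Circle

/-- The antipodal relation on the unit sphere of `ℝ³`. -/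
def antipodalRel (x y : Metric.sphere (0 : EuclideanSpace ℝ (Fin 3)) 1) : Prop :=
  y = -x

/-- The projective plane: the unit sphere of `ℝ³` with antipodal points identified, with the
quotient topology. -/
abbrev RealProjectivePlane : Type := Quot antipodalRel

/-- The side identifications of the unit square that give the Klein bottle:
`(x, 0) ∼ (x, 1)` and `(0, y) ∼ (1, 1 - y)`. -/
inductive KleinRel : unitInterval × unitInterval → unitInterval × unitInterval → Prop
  | parallel (x : unitInterval) : KleinRel (x, 0) (x, 1)
  | reversed (y : unitInterval) : KleinRel (0, y) (1, unitInterval.symm y)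

/-- The Klein bottle: the unit square with the above side identifications (under the equivalence
relation which they generate), with the quotient topology. -/
abbrev KleinBottle : Type := Quot KleinRel

end Mod2Degree

end

/-!
The cohomology of the torus is detected by an explicit cup product. For a map `f : X → S¹` let
`f^*ω` be the integral 1-cocycle which counts the turns of `f` along a singular 1-simplex: lift the
path to `ℝ` along `t ↦ exp (2πit)` and take the difference of the integer parts at its ends. The
lift extends over simplices of higher dimension, which makes this a cocycle. If `x` and `y` are the
two coordinates of the torus, then `x^*ω ∪ y^*ω` takes the value `1` modulo 2 on the 2-cycle formed
by the two triangles of the unit square (`cupTurns_torus_notMem`). Its class is therefore nonzero,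
hence it is the generator as soon as there is one, and a map `g` does not have degree `1` once
`g^*(x^*ω ∪ y^*ω) = (x ∘ g)^*ω ∪ (y ∘ g)^*ω` is a coboundary (`not_hasDegree_one`).

The latter holds whenever both coordinates of `g` are, up to factors that lift to `ℝ`, powers of a
single map `p : M → S¹` (`cupTurns_mem_coboundaries`). In this case the two 1-cocycles are integral
multiples of `c = p^*ω` up to integral coboundaries, and `c ∪ c` is the coboundary of
`-c (c - 1) / 2`. Here it matters that `c` is an integral cocycle and not just one modulo 2.

On the projective plane every map to the circle lifts to `ℝ` (`exists_lift_projectivePlane`), and on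
the Klein bottle every such map is a power of the projection to the circle, up to a factor that
lifts (`exists_eq_kleinProj_zpow_mul`). This replaces `H¹(P²; ℤ) = 0` and `H¹(K²; ℤ) = ℤ`.
-/

open scoped Simplicial

noncomputable section

namespace Mod2Degree

/-! ### Singular simplices as chains, and functions of simplices as cochains -/

/-- The geometric `n`-simplex. -/
abbrev Simplex (n : ℕ) : Type := stdSimplex ℝ (Fin (n + 1))

/-- The affine map of geometric simplices which is `f` on vertices. -/
def simplexMap {m n : ℕ} (f : Fin (m + 1) → Fin (n + 1)) : C(Simplex m, Simplex n) :=
  ⟨stdSimplex.map f, stdSimplex.continuous_map f⟩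

section Chains

variable {X Y : Type} [TopologicalSpace X] [TopologicalSpace Y] {n : ℕ}

/-- The singular simplices of `X`, as continuous maps from the geometric simplex and as the simplices
of the singular simplicial set. -/
def singularSimplexEquiv : C(Simplex n, X) ≃ (TopCat.toSSet.obj (TopCat.of X)) _⦋n⦌ :=
  ((TopCat.of X).toSSetObjEquiv (.op ⦋n⦌)).symm

theorem δ_singularSimplexEquiv (σ : C(Simplex (n + 1), X)) (i : Fin (n + 2)) :
    (TopCat.toSSet.obj (TopCat.of X)).δ i (singularSimplexEquiv σ) =
      singularSimplexEquiv (σ.comp (simplexMap i.succAbove)) := by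
  rfl

/-- The singular simplex `σ` as a chain. -/
def simplexChain (σ : C(Simplex n, X)) : (singularChains X).X n :=
  ((TopCat.toSSet.obj (TopCat.of X)).ιChainComplex (R := ModuleCat.of (ZMod 2) (ZMod 2))
    (singularSimplexEquiv σ)).hom (1 : ZMod 2)

/-- Modulo 2, the boundary of a singular simplex is the sum of its faces without signs. -/
theorem d_simplexChain (σ : C(Simplex (n + 1), X)) :
    ((singularChains X).d (n + 1) n).hom (simplexChain σ) =
      ∑ i : Fin (n + 2), simplexChain (σ.comp (simplexMap i.succAbove)) := by
  have h := SSet.ιChainComplex_d _ (ModuleCat.of (ZMod 2) (ZMod 2)) (singularSimplexEquiv σ)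
  have h2 := congrArg (fun f => f.hom (1 : ZMod 2)) h
  refine h2.trans ?_
  simp only [ModuleCat.hom_sum, LinearMap.sum_apply]
  refine Finset.sum_congr rfl fun i _ => ?_
  rw [δ_singularSimplexEquiv]
  rcases neg_one_pow_eq_or ℤ i.val with hi | hi
  · rw [hi, one_smul]; rfl
  · rw [hi, neg_one_smul, ModuleCat.hom_neg, LinearMap.neg_apply, ZModModule.neg_eq_self]; rfl

theorem singularChainsMap_simplexChain (f : C(X, Y)) (σ : C(Simplex n, X)) :
    ((singularChainsMap f).f n).hom (simplexChain σ) = simplexChain (f.comp σ) := by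
  have h := SSet.ι_chainComplexMap_f _ _ (TopCat.toSSet.map (TopCat.ofHom f))
    (ModuleCat.of (ZMod 2) (ZMod 2)) (singularSimplexEquiv σ)
  exact congrArg (fun f => f.hom (1 : ZMod 2)) h

theorem cochain_ext {φ ψ : Cochain (singularChains X) n}
    (h : ∀ σ : C(Simplex n, X), φ.toFun (simplexChain σ) = ψ.toFun (simplexChain σ)) : φ = ψ := by
  have key : ModuleCat.ofHom (X := (singularChains X).X n) φ = ModuleCat.ofHom ψ := by
    refine Limits.Sigma.hom_ext _ _ fun x => ?_
    obtain ⟨σ, rfl⟩ := singularSimplexEquiv.surjective x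
    exact ModuleCat.hom_ext (LinearMap.ext_ring (h σ))
  exact congrArg ModuleCat.Hom.hom key

/-- The cochain with prescribed values on the singular simplices. -/
def cochainOf (w : C(Simplex n, X) → ZMod 2) : Cochain (singularChains X) n :=
  (Limits.Sigma.desc (f := fun _ => ModuleCat.of (ZMod 2) (ZMod 2))
    (fun x : (TopCat.toSSet.obj (TopCat.of X)) _⦋n⦌ =>
      ModuleCat.ofHom (LinearMap.toSpanSingleton (ZMod 2) (ZMod 2)
        (w (singularSimplexEquiv.symm x))))).hom

theorem cochainOf_simplexChain (w : C(Simplex n, X) → ZMod 2) (σ : C(Simplex n, X)) :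
    (cochainOf w).toFun (simplexChain σ) = w σ := by
  have h := congrArg (fun f => f.hom (1 : ZMod 2)) (Limits.Sigma.ι_desc
    (f := fun _ => ModuleCat.of (ZMod 2) (ZMod 2))
    (fun x : (TopCat.toSSet.obj (TopCat.of X)) _⦋n⦌ =>
      ModuleCat.ofHom (LinearMap.toSpanSingleton (ZMod 2) (ZMod 2)
        (w (singularSimplexEquiv.symm x)))) (singularSimplexEquiv σ))
  refine Eq.trans h ?_
  simp

theorem coboundary_simplexChain (φ : Cochain (singularChains X) n) (σ : C(Simplex (n + 1), X)) :
    (coboundary (singularChains X) n (n + 1) φ).toFun (simplexChain σ) =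
      ∑ i : Fin (n + 2), φ.toFun (simplexChain (σ.comp (simplexMap i.succAbove))) := by
  change φ.toFun (((singularChains X).d (n + 1) n).hom (simplexChain σ)) = _
  rw [d_simplexChain]
  exact map_sum (M := (singularChains X).X n)
    (G := (singularChains X).X n →ₗ[ZMod 2] ZMod 2) φ _ _

theorem cochainMap_simplexChain (f : C(X, Y)) (φ : Cochain (singularChains Y) n)
    (σ : C(Simplex n, X)) :
    (cochainMap (singularChainsMap f) n φ).toFun (simplexChain σ) =
      φ.toFun (simplexChain (f.comp σ)) :=
  congrArg φ.toFun (singularChainsMap_simplexChain f σ)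

end Chains

/-! ### Lifting along the covering `ℝ → S¹` -/

/-- The covering map `t ↦ exp (2πit)` from the line to the circle. -/
def circleCover : C(ℝ, Circle) :=
  Circle.exp.comp ⟨fun t => 2 * Real.pi * t, by fun_prop⟩

theorem circleCover_eq_iff {s t : ℝ} : circleCover s = circleCover t ↔ ∃ n : ℤ, s = t + n := by
  have hpi := Real.pi_pos.ne'
  refine Circle.exp_eq_exp.trans (exists_congr fun n => ⟨fun h => ?_, fun h => ?_⟩)
  · change 2 * Real.pi * s = 2 * Real.pi * t + n * (2 * Real.pi) at h
    apply mul_left_cancel₀ (mul_ne_zero two_ne_zero hpi)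
    linear_combination h
  · subst h
    change 2 * Real.pi * (t + n) = 2 * Real.pi * t + n * (2 * Real.pi)
    ring

theorem circleCover_add (s t : ℝ) : circleCover (s + t) = circleCover s * circleCover t := by
  simp only [circleCover, ContinuousMap.comp_apply, ContinuousMap.coe_mk, mul_add]
  exact Circle.exp_add _ _

theorem circleCover_int_mul (n : ℤ) (t : ℝ) : circleCover (n * t) = circleCover t ^ n := by
  simp only [circleCover, ContinuousMap.comp_apply, ContinuousMap.coe_mk]
  rw [← Circle.exp_zsmul, zsmul_eq_mul]
  ring_nf

theorem circleCover_zero : circleCover 0 = 1 := by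
  simp [circleCover]

theorem circleCover_one : circleCover 1 = 1 := by
  rw [← circleCover_zero, circleCover_eq_iff]
  exact ⟨1, by simp⟩

/-- A map from a contractible space to the circle is null-homotopic, so that the homotopy lifting
property gives a lift to the line. -/
theorem exists_lift_of_contractible {A : Type} [TopologicalSpace A] [ContractibleSpace A]
    (f : C(A, Circle)) : ∃ θ : C(A, ℝ), ∀ a, circleCover (θ a) = f a := by
  obtain ⟨z, ⟨H⟩⟩ := (id_nullhomotopic A).comp_right f
  let H' := H.symm
  obtain ⟨t, ht⟩ := Circle.exp_surjective z
  let G := Circle.isCoveringMap_exp.liftHomotopy H'.toContinuousMap (.const A t) (fun a => by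
    simp [H', ht])
  have hG (a : A) : Circle.exp (G (1, a)) = f a := by
    have := congrFun (Circle.isCoveringMap_exp.liftHomotopy_lifts H'.toContinuousMap (.const A t)
      (fun a => by simp [H', ht])) (1, a)
    refine this.trans ?_
    simp [H']
  refine ⟨⟨fun a => G (1, a) / (2 * Real.pi), by fun_prop⟩, fun a => ?_⟩
  rw [← hG]
  have hpi := Real.pi_pos.ne'
  simp only [circleCover, ContinuousMap.comp_apply, ContinuousMap.coe_mk]
  congr 1
  field_simp

/-- A continuous real function with integral values on a connected space is constant. It is applied
to the difference of two lifts. -/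
theorem eq_of_forall_exists_int {A : Type} [TopologicalSpace A] [PreconnectedSpace A] {f : A → ℝ}
    (hf : Continuous f) (h : ∀ a, ∃ n : ℤ, f a = n) (a b : A) : f a = f b := by
  choose n hn using h
  have hc : Continuous n := by
    rw [Int.isClosedEmbedding_coe_real.isEmbedding.continuous_iff]
    exact hf.congr hn
  rw [hn, hn, PreconnectedSpace.constant ‹_› hc]

theorem contractibleSpace_simplex (n : ℕ) : ContractibleSpace (Simplex n) :=
  (convex_stdSimplex ℝ (Fin (n + 1))).contractibleSpace ⟨_, single_mem_stdSimplex ℝ 0⟩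

/-! ### The number of turns of a path in the circle -/

/-- The `i`-th vertex of the geometric simplex. -/
def vertex {n : ℕ} (i : Fin (n + 1)) : Simplex n := stdSimplex.vertex i

theorem simplexMap_vertex {m n : ℕ} (f : Fin (m + 1) → Fin (n + 1)) (i : Fin (m + 1)) :
    simplexMap f (vertex i) = vertex (f i) :=
  stdSimplex.map_vertex f i

theorem simplexMap_comp {l m n : ℕ} (f : Fin (m + 1) → Fin (n + 1))
    (g : Fin (l + 1) → Fin (m + 1)) :
    (simplexMap f).comp (simplexMap g) = simplexMap (f ∘ g) :=
  ContinuousMap.ext fun x => stdSimplex.map_comp_apply g f x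

theorem exists_lift_simplex {n : ℕ} (f : C(Simplex n, Circle)) :
    ∃ θ : C(Simplex n, ℝ), ∀ x, circleCover (θ x) = f x :=
  have := contractibleSpace_simplex n
  exists_lift_of_contractible f

/-- The number of turns of a path in the circle: for a lift `θ` of the path to the line, it is the
difference of the integer parts of `θ` at the ends of the path. It does not depend on the lift
(`turns_eq`), and it is defined for paths that are not closed, which makes it a singular 1-cocycle
with integer values. -/
def turns (γ : C(Simplex 1, Circle)) : ℤ :=
  ⌊(exists_lift_simplex γ).choose (vertex 1)⌋ - ⌊(exists_lift_simplex γ).choose (vertex 0)⌋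

theorem turns_eq {γ : C(Simplex 1, Circle)} {θ : Simplex 1 → ℝ} (hc : Continuous θ)
    (hθ : ∀ x, circleCover (θ x) = γ x) : turns γ = ⌊θ (vertex 1)⌋ - ⌊θ (vertex 0)⌋ := by
  have hl := (exists_lift_simplex γ).choose_spec
  set l := (exists_lift_simplex γ).choose with l_def
  have hn (x) : ∃ n : ℤ, θ x - l x = n := by
    obtain ⟨n, h⟩ := circleCover_eq_iff.1 ((hθ x).trans (hl x).symm)
    exact ⟨n, by linarith⟩
  have := contractibleSpace_simplex 1
  have hconst : θ (vertex 1) - l (vertex 1) = θ (vertex 0) - l (vertex 0) :=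
    eq_of_forall_exists_int (hc.sub l.continuous) hn (vertex 1) (vertex 0)
  obtain ⟨n, h0⟩ := hn (vertex 0)
  have e0 : θ (vertex 0) = l (vertex 0) + n := by linarith
  have e1 : θ (vertex 1) = l (vertex 1) + n := by linarith
  rw [turns, ← l_def, e0, e1, Int.floor_add_intCast, Int.floor_add_intCast]
  ring

theorem turns_comp_simplexMap {n : ℕ} {σ : C(Simplex n, Circle)} {θ : Simplex n → ℝ}
    (hc : Continuous θ) (hθ : ∀ x, circleCover (θ x) = σ x) (f : Fin 2 → Fin (n + 1)) :
    turns (σ.comp (simplexMap f)) = ⌊θ (vertex (f 1))⌋ - ⌊θ (vertex (f 0))⌋ := by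
  rw [turns_eq (γ := σ.comp (simplexMap f)) (hc.comp (simplexMap f).continuous) fun x => hθ _]
  simp [simplexMap_vertex]

/-- If `f` is the `m`-th power of `p` up to a factor that lifts to the line, then the cocycles of `f`
and `p` satisfy `f^*ω = m p^*ω + δD` for an integral 0-cochain `D`. -/
theorem exists_turns_eq_of_eq_zpow_mul {X : Type} [TopologicalSpace X] (p : C(X, Circle)) (m : ℤ)
    (ψ : C(X, ℝ)) {f : C(X, Circle)} (hf : ∀ x, f x = p x ^ m * circleCover (ψ x)) :
    ∃ D : X → ℤ, ∀ γ : C(Simplex 1, X),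
      turns (f.comp γ) = m * turns (p.comp γ) + D (γ (vertex 1)) - D (γ (vertex 0)) := by
  have hsurj (x : X) : ∃ t : ℝ, circleCover t = p x := by
    obtain ⟨t, ht⟩ := exists_lift_of_contractible (ContinuousMap.const Unit (p x))
    exact ⟨t (), ht ()⟩
  choose s hs using hsurj
  -- The value of `D` at `x` may be computed from any preimage `t` of `p x` in the line.
  have hD (x : X) (t : ℝ) (ht : circleCover t = p x) :
      ⌊m * s x + ψ x⌋ - m * ⌊s x⌋ = ⌊m * t + ψ x⌋ - m * ⌊t⌋ := by
    obtain ⟨n, hn⟩ := circleCover_eq_iff.1 ((hs x).trans ht.symm)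
    have : (m : ℝ) * s x + ψ x = m * t + ψ x + ((m * n : ℤ) : ℝ) := by
      rw [hn]; push_cast; ring
    rw [this, hn, Int.floor_add_intCast, Int.floor_add_intCast]
    ring
  refine ⟨fun x => ⌊m * s x + ψ x⌋ - m * ⌊s x⌋, fun γ => ?_⟩
  obtain ⟨θ, hθ⟩ := exists_lift_simplex (p.comp γ)
  rw [turns_eq θ.continuous hθ, turns_eq (θ := fun x => m * θ x + ψ (γ x)) (by fun_prop)]
  · simp only
    rw [hD _ _ (hθ (vertex 1)), hD _ _ (hθ (vertex 0))]
    ring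
  · intro x
    rw [circleCover_add, circleCover_int_mul, hθ]
    exact (hf _).symm

/-! ### The cup product of two turning cocycles -/

section Cup

variable {X Y : Type} [TopologicalSpace X] [TopologicalSpace Y]

/-- The cup product modulo 2 of the turning cocycles of `f` and `g`: on a 2-simplex it is the number
of turns of `f` on the front edge times the number of turns of `g` on the back edge. -/
def cupTurns (f g : C(X, Circle)) : Cochain (singularChains X) 2 :=
  cochainOf fun σ =>
    ((turns (f.comp (σ.comp (simplexMap ![0, 1]))) *
      turns (g.comp (σ.comp (simplexMap ![1, 2]))) : ℤ) : ZMod 2)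

theorem cochainMap_cupTurns (h : C(Y, X)) (f g : C(X, Circle)) :
    cochainMap (singularChainsMap h) 2 (cupTurns f g) = cupTurns (f.comp h) (g.comp h) :=
  cochain_ext fun σ => by
    rw [cochainMap_simplexChain, cupTurns, cupTurns, cochainOf_simplexChain,
      cochainOf_simplexChain]
    rfl

/-- The number of turns on an edge of a face, in terms of a lift on the whole simplex. -/
theorem turns_comp_face {n : ℕ} (f : C(X, Circle)) (σ : C(Simplex (n + 1), X))
    {θ : Simplex (n + 1) → ℝ} (hc : Continuous θ) (hθ : ∀ x, circleCover (θ x) = f (σ x))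
    (i : Fin (n + 2)) (a : Fin 2 → Fin (n + 1)) :
    turns (f.comp ((σ.comp (simplexMap i.succAbove)).comp (simplexMap a))) =
      ⌊θ (vertex (i.succAbove (a 1)))⌋ - ⌊θ (vertex (i.succAbove (a 0)))⌋ := by
  rw [ContinuousMap.comp_assoc, simplexMap_comp, ← ContinuousMap.comp_assoc]
  exact turns_comp_simplexMap hc hθ _

theorem zmod_two_cast_eq {a b k : ℤ} (h : a = b + 2 * k) : (a : ZMod 2) = b := by
  rw [h, Int.cast_add, Int.cast_mul, show ((2 : ℤ) : ZMod 2) = 0 from rfl, zero_mul, add_zero]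

theorem coboundary_cupTurns (f g : C(X, Circle)) :
    coboundary (singularChains X) 2 3 (cupTurns f g) = 0 :=
  cochain_ext fun τ => by
    rw [coboundary_simplexChain]
    obtain ⟨s, hs⟩ := exists_lift_simplex (f.comp τ)
    obtain ⟨t, ht⟩ := exists_lift_simplex (g.comp τ)
    simp only [cupTurns, cochainOf_simplexChain, turns_comp_face f τ s.continuous hs,
      turns_comp_face g τ t.continuous ht]
    rw [← Int.cast_sum]
    -- The alternating sum over the faces vanishes; `2 * k` corrects the signs of the odd faces.
    refine (zmod_two_cast_eq (b := 0)
      (k := (⌊s (vertex 2)⌋ - ⌊s (vertex 0)⌋) * (⌊t (vertex 3)⌋ - ⌊t (vertex 2)⌋) +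
        (⌊s (vertex 1)⌋ - ⌊s (vertex 0)⌋) * (⌊t (vertex 2)⌋ - ⌊t (vertex 1)⌋)) ?_).trans
      Int.cast_zero
    rw [Fin.sum_univ_four]
    change (⌊s (vertex 2)⌋ - ⌊s (vertex 1)⌋) * (⌊t (vertex 3)⌋ - ⌊t (vertex 2)⌋) +
      (⌊s (vertex 2)⌋ - ⌊s (vertex 0)⌋) * (⌊t (vertex 3)⌋ - ⌊t (vertex 2)⌋) +
      (⌊s (vertex 1)⌋ - ⌊s (vertex 0)⌋) * (⌊t (vertex 3)⌋ - ⌊t (vertex 1)⌋) +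
      (⌊s (vertex 1)⌋ - ⌊s (vertex 0)⌋) * (⌊t (vertex 2)⌋ - ⌊t (vertex 1)⌋) = _
    ring

theorem add_mul_pred_div_two (x y : ℤ) :
    (x + y) * (x + y - 1) / 2 = x * (x - 1) / 2 + y * (y - 1) / 2 + x * y := by
  obtain ⟨a, ha⟩ := (Int.even_mul_pred_self x).two_dvd
  obtain ⟨b, hb⟩ := (Int.even_mul_pred_self y).two_dvd
  have h : (x + y) * (x + y - 1) = 2 * (a + b + x * y) := by linear_combination ha + hb
  rw [h, ha, hb]
  simp

/-- If `f^*ω = m c + δF` and `g^*ω = n c + δG` for a single integral cocycle `c`, then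
`f^*ω ∪ g^*ω` is the coboundary of `F ∪ g^*ω - m c ∪ G - m n c (c - 1) / 2`. -/
theorem cupTurns_mem_coboundaries {p : C(X, Circle)} {m n : ℤ} {φ ψ : C(X, ℝ)}
    {f g : C(X, Circle)}
    (hf : ∀ x, f x = p x ^ m * circleCover (φ x)) (hg : ∀ x, g x = p x ^ n * circleCover (ψ x)) :
    cupTurns f g ∈ coboundaries (singularChains X) 2 := by
  obtain ⟨F, hF⟩ := exists_turns_eq_of_eq_zpow_mul p m φ hf
  obtain ⟨G, hG⟩ := exists_turns_eq_of_eq_zpow_mul p n ψ hg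
  let η (γ : C(Simplex 1, X)) : ℤ := F (γ (vertex 0)) * turns (g.comp γ)
    - m * turns (p.comp γ) * G (γ (vertex 1))
    - m * n * (turns (p.comp γ) * (turns (p.comp γ) - 1) / 2)
  refine ⟨cochainOf fun γ => (η γ : ZMod 2), cochain_ext fun σ => ?_⟩
  refine (coboundary_simplexChain _ σ).trans ?_
  simp only [cupTurns, cochainOf_simplexChain]
  rw [← Int.cast_sum]
  -- The integral coboundary of `η` is the product; modulo 2 the sign of the middle face is dropped.
  refine zmod_two_cast_eq (k := η (σ.comp (simplexMap (Fin.succAbove 1)))) ?_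
  obtain ⟨s, hs⟩ := exists_lift_simplex (p.comp σ)
  have hp (a : Fin 2 → Fin 3) : turns (p.comp (σ.comp (simplexMap a))) =
      ⌊s (vertex (a 1))⌋ - ⌊s (vertex (a 0))⌋ := turns_comp_simplexMap s.continuous hs a
  have hη (a : Fin 2 → Fin 3) : η (σ.comp (simplexMap a)) =
      F (σ (vertex (a 0))) * (n * (⌊s (vertex (a 1))⌋ - ⌊s (vertex (a 0))⌋)
        + G (σ (vertex (a 1))) - G (σ (vertex (a 0))))
      - m * (⌊s (vertex (a 1))⌋ - ⌊s (vertex (a 0))⌋) * G (σ (vertex (a 1)))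
      - m * n * ((⌊s (vertex (a 1))⌋ - ⌊s (vertex (a 0))⌋) *
        ((⌊s (vertex (a 1))⌋ - ⌊s (vertex (a 0))⌋) - 1) / 2) := by
    simp only [η, hG, hp, ContinuousMap.comp_apply, simplexMap_vertex]
  have h0 := hη (Fin.succAbove 0)
  have h1 := hη (Fin.succAbove 1)
  have h2 := hη (Fin.succAbove 2)
  have hT := add_mul_pred_div_two (⌊s (vertex 1)⌋ - ⌊s (vertex 0)⌋)
    (⌊s (vertex 2)⌋ - ⌊s (vertex 1)⌋)
  rw [show ⌊s (vertex 1)⌋ - ⌊s (vertex 0)⌋ + (⌊s (vertex 2)⌋ - ⌊s (vertex 1)⌋) =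
    ⌊s (vertex 2)⌋ - ⌊s (vertex 0)⌋ by ring] at hT
  refine (Fin.sum_univ_three _).trans ?_
  simp only [hF, hG, hp, ContinuousMap.comp_apply, simplexMap_vertex]
  rw [h0, h1, h2]
  simp only [show Fin.succAbove (0 : Fin 3) 0 = 1 from rfl,
    show Fin.succAbove (0 : Fin 3) 1 = 2 from rfl, show Fin.succAbove (1 : Fin 3) 0 = 0 from rfl,
    show Fin.succAbove (1 : Fin 3) 1 = 2 from rfl, show Fin.succAbove (2 : Fin 3) 0 = 0 from rfl,
    show Fin.succAbove (2 : Fin 3) 1 = 1 from rfl, Matrix.cons_val_zero, Matrix.cons_val_one]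
  rw [hT]
  ring

/-! ### The fundamental cycle of the torus -/

theorem continuous_simplex_apply {n : ℕ} (i : Fin (n + 1)) :
    Continuous fun x : Simplex n => x i :=
  (continuous_apply i).comp continuous_subtype_val

/-- The triangle with the vertices `(0, 0)`, `(1, 0)`, `(1, 1)` of the unit square, mapped to the
torus. -/
def triangleXY : C(Simplex 2, Torus) where
  toFun x := (circleCover (x 1 + x 2), circleCover (x 2))
  continuous_toFun := by
    have hx := continuous_simplex_apply (n := 2)
    exact (circleCover.continuous.comp ((hx 1).add (hx 2))).prodMk
      (circleCover.continuous.comp (hx 2))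

/-- The triangle with the vertices `(0, 0)`, `(0, 1)`, `(1, 1)` of the unit square, mapped to the
torus. -/
def triangleYX : C(Simplex 2, Torus) where
  toFun x := (circleCover (x 2), circleCover (x 1 + x 2))
  continuous_toFun := by
    have hx := continuous_simplex_apply (n := 2)
    exact (circleCover.continuous.comp (hx 2)).prodMk
      (circleCover.continuous.comp ((hx 1).add (hx 2)))

theorem simplexMap_succAbove_apply_succAbove {n : ℕ} (i : Fin (n + 2)) (j : Fin (n + 1))
    (x : Simplex n) : simplexMap i.succAbove x (i.succAbove j) = x j := by
  classical
  change FunOnFinite.linearMap ℝ ℝ i.succAbove x (i.succAbove j) = x j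
  rw [FunOnFinite.linearMap_apply_apply]
  simp [Finset.filter_eq']

theorem simplexMap_succAbove_apply_self {n : ℕ} (i : Fin (n + 2)) (x : Simplex n) :
    simplexMap i.succAbove x i = 0 := by
  classical
  change FunOnFinite.linearMap ℝ ℝ i.succAbove x i = 0
  rw [FunOnFinite.linearMap_apply_apply]
  simp [Fin.succAbove_ne]

theorem vertex_apply {n : ℕ} (i j : Fin (n + 1)) :
    (vertex i : Simplex n) j = if j = i then 1 else 0 :=
  Pi.single_apply i (1 : ℝ) j

/-- The sum of the two triangles is a cycle modulo 2, on which the cup product of the coordinates has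
the value `1`. -/
theorem cupTurns_torus_notMem :
    cupTurns (X := Torus) ContinuousMap.fst ContinuousMap.snd ∉
      coboundaries (singularChains Torus) 2 := by
  rintro ⟨η, hη⟩
  have e (x : Simplex 1) : x 0 + x 1 = 1 := stdSimplex.add_eq_one x
  have c0 := circleCover_zero
  have c1 := circleCover_one
  have a00 (x : Simplex 1) : simplexMap (Fin.succAbove (0 : Fin 3)) x 1 = x 0 :=
    simplexMap_succAbove_apply_succAbove 0 0 x
  have a01 (x : Simplex 1) : simplexMap (Fin.succAbove (0 : Fin 3)) x 2 = x 1 :=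
    simplexMap_succAbove_apply_succAbove 0 1 x
  have a1 (x : Simplex 1) : simplexMap (Fin.succAbove (1 : Fin 3)) x 1 = 0 :=
    simplexMap_succAbove_apply_self 1 x
  have a2 (x : Simplex 1) : simplexMap (Fin.succAbove (2 : Fin 3)) x 2 = 0 :=
    simplexMap_succAbove_apply_self 2 x
  have a21 (x : Simplex 1) : simplexMap (Fin.succAbove (2 : Fin 3)) x 1 = x 1 :=
    simplexMap_succAbove_apply_succAbove 2 1 x
  have f1 : triangleXY.comp (simplexMap (Fin.succAbove 1)) =
      triangleYX.comp (simplexMap (Fin.succAbove 1)) :=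
    ContinuousMap.ext fun x => by
      simp [triangleXY, triangleYX, a1]
  have f0 : triangleXY.comp (simplexMap (Fin.succAbove 0)) =
      triangleYX.comp (simplexMap (Fin.succAbove 2)) :=
    ContinuousMap.ext fun x => by
      simp [triangleXY, triangleYX, a00, a01, a2, a21, e, c0, c1, -Fin.succAbove_zero]
  have f2 : triangleXY.comp (simplexMap (Fin.succAbove 2)) =
      triangleYX.comp (simplexMap (Fin.succAbove 0)) :=
    ContinuousMap.ext fun x => by
      simp [triangleXY, triangleYX, a00, a01, a2, a21, e, c0, c1, -Fin.succAbove_zero]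
  have hsum (σ : C(Simplex 2, Torus)) := ((Fin.sum_univ_three _).symm.trans
    (coboundary_simplexChain η σ).symm).trans
      (congrArg (fun φ => φ.toFun (simplexChain σ)) hη)
  have hXY := hsum triangleXY
  have hYX := hsum triangleYX
  have hx := continuous_simplex_apply (n := 2)
  have tXY : turns (ContinuousMap.fst.comp (triangleXY.comp (simplexMap ![0, 1]))) = 1 := by
    refine (turns_comp_simplexMap (σ := ContinuousMap.fst.comp triangleXY)
      (θ := fun x => x 1 + x 2) ((hx 1).add (hx 2)) (fun _ => rfl) _).trans ?_
    simp [vertex_apply]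
  have tXY' : turns (ContinuousMap.snd.comp (triangleXY.comp (simplexMap ![1, 2]))) = 1 := by
    refine (turns_comp_simplexMap (σ := ContinuousMap.snd.comp triangleXY)
      (θ := fun x => x 2) (hx 2) (fun _ => rfl) _).trans ?_
    simp [vertex_apply]
  have tYX : turns (ContinuousMap.fst.comp (triangleYX.comp (simplexMap ![0, 1]))) = 0 := by
    refine (turns_comp_simplexMap (σ := ContinuousMap.fst.comp triangleYX)
      (θ := fun x => x 2) (hx 2) (fun _ => rfl) _).trans ?_
    simp [vertex_apply]
  simp only [cupTurns, cochainOf_simplexChain, tXY, tXY', f0, f1, f2] at hXY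
  simp only [cupTurns, cochainOf_simplexChain, tYX, zero_mul] at hYX
  have key := (hXY.symm.trans ?_).trans hYX
  · simp at key
  · abel

/-- The class of `cupTurns` in the cohomology of the torus is nonzero, so that it is a nonzero multiple
of any generator; if its pullback vanishes, then so does the pullback of the generator. -/
theorem not_hasDegree_one {M : Type} [TopologicalSpace M] (g : C(M, Torus))
    (hg : cupTurns (ContinuousMap.fst.comp g) (ContinuousMap.snd.comp g) ∈
      coboundaries (singularChains M) 2) :
    ¬ HasDegree 2 g 1 := by
  rintro ⟨u, v, hu, hv, huv⟩
  let w : cocycles (singularChains Torus) 2 :=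
    ⟨cupTurns ContinuousMap.fst ContinuousMap.snd, coboundary_cupTurns _ _⟩
  let c : SingularCohomology Torus 2 := Submodule.Quotient.mk w
  have hc : c ≠ 0 := fun h => cupTurns_torus_notMem
    ((Submodule.Quotient.mk_eq_zero ((coboundaries _ 2).comap (cocycles _ 2).subtype)).1 h)
  have hp : pullback g 2 c = 0 := by
    refine (Submodule.Quotient.mk_eq_zero ((coboundaries _ 2).comap (cocycles _ 2).subtype)).2 ?_
    change cochainMap (singularChainsMap g) 2 (cupTurns ContinuousMap.fst ContinuousMap.snd) ∈
      coboundaries (singularChains M) 2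
    rwa [cochainMap_cupTurns]
  obtain ⟨k, hk⟩ := hu.2 c
  have hk0 : k ≠ 0 := by
    rintro rfl
    exact hc (hk.trans (zero_smul _ _))
  rw [hk, map_smul, huv, one_smul] at hp
  exact smul_ne_zero hk0 hv.1 hp

end Cup

/-! ### The Klein bottle -/

theorem contractibleSpace_unitInterval : ContractibleSpace unitInterval :=
  (convex_Icc (0 : ℝ) 1).contractibleSpace ⟨0, by simp⟩

/-- The projection `[x, y] ↦ exp (2πix)` of the Klein bottle to the circle. -/
def kleinProj : C(KleinBottle, Circle) where
  toFun := Quot.lift (fun x => circleCover x.1) fun a b h => by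
    cases h with
    | parallel x => rfl
    | reversed y => simp [circleCover_zero, circleCover_one]
  continuous_toFun := by
    refine continuous_quot_lift _ ?_
    exact circleCover.continuous.comp (continuous_subtype_val.comp continuous_fst)

/-- Over the square, a map from the Klein bottle to the circle lifts to a function `θ`. The increment
of `θ` across the parallel sides vanishes, and `θ` descends after subtracting `m x`, where `m` is its
increment across the reversed sides. -/
theorem exists_eq_kleinProj_zpow_mul (f : C(KleinBottle, Circle)) :
    ∃ (m : ℤ) (ψ : C(KleinBottle, ℝ)), ∀ x, f x = kleinProj x ^ m * circleCover (ψ x) := by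
  have := contractibleSpace_unitInterval
  obtain ⟨θ, hθ⟩ := exists_lift_of_contractible
    (f.comp ⟨Quot.mk KleinRel, continuous_quot_mk⟩)
  have hint {x y} (h : KleinRel x y) : ∃ n : ℤ, θ y - θ x = n := by
    have h1 : circleCover (θ y) = circleCover (θ x) := by
      rw [hθ, hθ]
      exact congrArg f (Quot.sound h).symm
    obtain ⟨n, hn⟩ := circleCover_eq_iff.1 h1
    exact ⟨n, by linarith⟩
  have ha := eq_of_forall_exists_int (f := fun x => θ (x, 1) - θ (x, 0)) (by fun_prop)
    fun x => hint (.parallel x)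
  have hb := eq_of_forall_exists_int (f := fun y => θ (1, unitInterval.symm y) - θ (0, y))
    (by fun_prop) fun y => hint (.reversed y)
  obtain ⟨m, hm⟩ := hint (.reversed 0)
  -- At the corners of the square the two kinds of relations give `b = 2 a + b` for the increments
  -- `a` of `θ` across the parallel sides and `b` across the reversed ones. Hence `a = 0`.
  have hb01 := hb 1 0
  have ha01 := ha 0 1
  simp only [unitInterval.symm_one, unitInterval.symm_zero] at hb01 hm ha01
  have ha0 (x) : θ (x, 1) = θ (x, 0) := by linarith [ha x 0]
  have hbm (y) : θ (1, unitInterval.symm y) - θ (0, y) = m := by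
    have := hb y 0
    simp only [unitInterval.symm_zero] at this
    linarith
  let ψ : C(KleinBottle, ℝ) :=
    ⟨Quot.lift (fun x => θ x - m * x.1) fun a b h => by
      cases h with
      | parallel x => simp [ha0]
      | reversed y =>
        have := hbm y
        simp only [Set.Icc.coe_zero, Set.Icc.coe_one]
        linarith, continuous_quot_lift _ (by fun_prop)⟩
  refine ⟨m, ψ, fun x => ?_⟩
  induction x using Quot.ind with
  | mk x =>
    change f (Quot.mk _ x) = circleCover x.1 ^ m * circleCover (θ x - m * x.1)
    rw [← circleCover_int_mul, ← circleCover_add, add_sub_cancel, hθ]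
    rfl

/-! ### The projective plane -/

/-- The closed unit disc. -/
abbrev Disc : Type := Metric.closedBall (0 : ℂ) 1

/-- The unit sphere of `ℝ³`. -/
abbrev Sphere : Type := Metric.sphere (0 : EuclideanSpace ℝ (Fin 3)) 1

theorem sphere_sum_sq (x : Sphere) : x.1 0 ^ 2 + x.1 1 ^ 2 + x.1 2 ^ 2 = 1 := by
  have h := x.2
  rw [mem_sphere_zero_iff_norm, EuclideanSpace.norm_eq, Real.sqrt_eq_one, Fin.sum_univ_three] at h
  simpa using h

/-- The disc as the upper hemisphere. -/
def hemisphere : C(Disc, Sphere) where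
  toFun z := ⟨!₂[z.1.re, z.1.im, √(1 - ‖z.1‖ ^ 2)], by
    have h := mem_closedBall_zero_iff.1 z.2
    have h1 : 0 ≤ 1 - ‖z.1‖ ^ 2 := by nlinarith [norm_nonneg z.1]
    rw [mem_sphere_zero_iff_norm, EuclideanSpace.norm_eq, Real.sqrt_eq_one, Fin.sum_univ_three]
    have h2 : ‖z.1‖ ^ 2 = z.1.re ^ 2 + z.1.im ^ 2 := by
      rw [Complex.sq_norm, Complex.normSq_apply, sq, sq]
    rw [h2] at h1
    simp [Real.sq_sqrt h1, h2]⟩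
  continuous_toFun := by
    refine Continuous.subtype_mk ((PiLp.continuous_toLp 2 _).comp (continuous_pi fun i => ?_)) _
    fin_cases i <;> simp <;> fun_prop

/-- The vertical projection of the sphere to the disc. -/
def flatten : C(Sphere, Disc) where
  toFun x := ⟨⟨x.1 0, x.1 1⟩, by
    rw [mem_closedBall_zero_iff, ← sq_le_one_iff₀ (norm_nonneg _), Complex.sq_norm,
      Complex.normSq_mk]
    nlinarith [sphere_sum_sq x, sq_nonneg (x.1 2)]⟩
  continuous_toFun := by
    refine Continuous.subtype_mk (f := fun x : Sphere => (⟨x.1 0, x.1 1⟩ : ℂ)) ?_ _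
    exact Complex.equivRealProdCLM.symm.continuous.comp
      (f := fun x : Sphere => (x.1 0, x.1 1)) (by fun_prop)

theorem hemisphere_flatten {x : Sphere} (hx : 0 ≤ x.1 2) : hemisphere (flatten x) = x := by
  refine Subtype.ext (PiLp.ext fun i => ?_)
  fin_cases i
  · rfl
  · rfl
  · change √(1 - ‖(⟨x.1 0, x.1 1⟩ : ℂ)‖ ^ 2) = x.1 2
    rw [Complex.sq_norm, Complex.normSq_mk, ← Real.sqrt_sq hx]
    congr 1
    linarith [sphere_sum_sq x]

/-- The projective plane is the disc with antipodal points of its boundary identified. A lift `θ` over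
the disc has a constant increment between antipodal boundary points; as this increment also changes
sign under the antipodal map, it is zero, and `θ` descends. -/
theorem exists_lift_projectivePlane (f : C(RealProjectivePlane, Circle)) :
    ∃ ψ : C(RealProjectivePlane, ℝ), ∀ x, circleCover (ψ x) = f x := by
  have : ContractibleSpace Disc := (convex_closedBall (0 : ℂ) 1).contractibleSpace ⟨0, by simp⟩
  let q : C(Sphere, RealProjectivePlane) := ⟨Quot.mk antipodalRel, continuous_quot_mk⟩
  have hq (x : Sphere) : q (-x) = q x := (Quot.sound (r := antipodalRel) (a := x) rfl).symm
  obtain ⟨θ, hθ⟩ := exists_lift_of_contractible (f.comp (q.comp hemisphere))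
  let l (x : Sphere) : ℝ := θ (flatten x)
  have hl {x : Sphere} (hx : 0 ≤ x.1 2) : circleCover (l x) = f (q x) := by
    rw [hθ]
    simp only [ContinuousMap.comp_apply, hemisphere_flatten hx]
  let b (z : Metric.sphere (0 : ℂ) 1) : Disc := ⟨z, Metric.sphere_subset_closedBall z.2⟩
  have hb : Continuous b := by fun_prop
  have hbl (z) : hemisphere (b (-z)) = -hemisphere (b z) := by
    have h1 : ‖z.1‖ = 1 := mem_sphere_zero_iff_norm.1 z.2
    refine Subtype.ext (PiLp.ext fun i => ?_)
    fin_cases i <;> simp [hemisphere, b, h1]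
  have : PreconnectedSpace (Metric.sphere (0 : ℂ) 1) :=
    Subtype.preconnectedSpace (isPreconnected_sphere (by simp) 0 1)
  have hint (z) : ∃ n : ℤ, θ (b (-z)) - θ (b z) = n := by
    have h1 : circleCover (θ (b (-z))) = circleCover (θ (b z)) := by
      rw [hθ, hθ]
      simp only [ContinuousMap.comp_apply, hbl, hq]
    obtain ⟨n, hn⟩ := circleCover_eq_iff.1 h1
    exact ⟨n, by linarith⟩
  have hneg (z) : θ (b (-z)) = θ (b z) := by
    have := eq_of_forall_exists_int (f := fun z => θ (b (-z)) - θ (b z))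
      (by fun_prop) hint z (-z)
    simp only [neg_neg] at this
    linarith
  have hlneg {x : Sphere} (hx : x.1 2 = 0) : l (-x) = l x := by
    have hz : (⟨x.1 0, x.1 1⟩ : ℂ) ∈ Metric.sphere (0 : ℂ) 1 := by
      rw [mem_sphere_zero_iff_norm, ← pow_eq_one_iff_of_nonneg (norm_nonneg _) two_ne_zero,
        Complex.sq_norm, Complex.normSq_mk]
      have := sphere_sum_sq x
      rw [hx] at this
      linarith
    have h1 : flatten (-x) = b (-⟨_, hz⟩) :=
      Subtype.ext (Complex.ext rfl rfl)
    exact (congrArg θ h1).trans (hneg ⟨_, hz⟩)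
  let L (x : Sphere) : ℝ := if 0 ≤ x.1 2 then l x else l (-x)
  have hLc : Continuous L := by
    refine Continuous.if_le (by fun_prop) (by fun_prop) continuous_const (by fun_prop) ?_
    intro x hx
    exact (hlneg hx.symm).symm
  have hneg2 (x : Sphere) : (-x).1 2 = - x.1 2 := rfl
  have hL (x) : L (-x) = L x := by
    rcases lt_trichotomy (x.1 2) 0 with h | h | h
    · simp only [L, hneg2]
      rw [if_pos (by linarith), if_neg (by linarith)]
    · simp only [L, hneg2]
      rw [if_pos (by linarith), if_pos (by linarith), hlneg h]
    · simp only [L, hneg2]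
      rw [if_neg (by linarith), if_pos (by linarith), neg_neg]
  refine ⟨⟨Quot.lift L fun x y h => ?_, continuous_quot_lift _ hLc⟩, fun x => ?_⟩
  · rw [show y = -x from h, hL]
  · induction x using Quot.ind with
    | mk x =>
      change circleCover (L x) = f (q x)
      by_cases h : 0 ≤ x.1 2
      · simp only [L, if_pos h, hl h]
      · simp only [L, if_neg h]
        rw [hl (by rw [hneg2]; linarith), hq]

end Mod2Degree

end


theorem theorem3p2 :
    (¬ ∃ g : C(Mod2Degree.RealProjectivePlane, Mod2Degree.Torus), Mod2Degree.HasDegree 2 g 1) ∧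
    (¬ ∃ g : C(Mod2Degree.KleinBottle, Mod2Degree.Torus), Mod2Degree.HasDegree 2 g 1) := by
  open Mod2Degree in
  constructor
  · rintro ⟨g, hg⟩
    obtain ⟨φ, hφ⟩ := exists_lift_projectivePlane (ContinuousMap.fst.comp g)
    obtain ⟨ψ, hψ⟩ := exists_lift_projectivePlane (ContinuousMap.snd.comp g)
    -- Both coordinates lift, so that `p` may be constant.
    refine not_hasDegree_one g (cupTurns_mem_coboundaries (p := .const _ 1) (m := 0) (n := 0)
      (φ := φ) (ψ := ψ) (fun x => ?_) fun x => ?_) hg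
    · simp [hφ]
    · simp [hψ]
  · rintro ⟨g, hg⟩
    obtain ⟨m, φ, hφ⟩ := exists_eq_kleinProj_zpow_mul (ContinuousMap.fst.comp g)
    obtain ⟨n, ψ, hψ⟩ := exists_eq_kleinProj_zpow_mul (ContinuousMap.snd.comp g)
    exact not_hasDegree_one g (cupTurns_mem_coboundaries hφ hψ) hg
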